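/- **Setting.** Let $G=(V,E)$ be a finite simple graph with $n=|V|\ge 1$ vertices and maximum degree at most $\Delta$. An algorithm knows $V$ and accesses $G$ only through a degree oracle $\mathcal D(v)$ and a neighbor oracle $\mathcal N(v,i)$, $1\le i\le \mathcal D(v)$, which returns the $i$-th neighbor of $v$ (in an arbitrary order); its query complexity is the number of oracle accesses. **Algorithm.** Let $\lambda>0$, $\epsilon>0$. For $v\in V$ and $h\ge 1$ let $x^{[h]}(v)$ be the value at the root of the solution of $x_u=1/(1+\lambda\sum_{w}x_w)$ ($w$ ranging over the children of $u$) on the tree of simple paths $v=v_0v_1\cdots v_k$ of $G$ truncated at $k\le h-1$ (with $x_u=1$ at the last level $k=h-1$); it is computed by a depth-first search that queries $\mathcal D(s)$ and all $\mathcal N(s,i)$ at every node, with endpoint $s$, above the last level. *Approx-Marginal*$(\lambda,\epsilon,v)$ computes $x^{[1]}(v),x^{[2]}(v),\dots$ and returns the first $x^{[h]}(v)$, $h\ge 2$, with $|\log x^{[h]}(v)-\log x^{[h-1]}(v)|\le \epsilon/e$. *Approx-Matching-Statistics*$(\lambda,\epsilon)$, with a fixed constant $C>0$, samples $s=\lceil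 C/\epsilon^2\rceil$ vertices $u_1,\dots,u_s$ of $V$ independently and uniformly at random and returns $$\frac n2-\frac{n}{2s}\sum_{j=1}^{s}\text{Approx-Marginal}(\lambda,\epsilon/2,u_j).$$ **Proposition.** There is an absolute constant $C>0$ such that the following holds with $\lambda=\exp\!\big(\frac{\Delta\log 2}{2\epsilon}\big)$. 1. For all $\Delta\ge 0$ and $\epsilon>0$, and for every nonempty finite graph $G$ of maximum degree at most $\Delta$, the output of Approx-Matching-Statistics$(\lambda,\epsilon)$ differs from the size of a maximum matching of $G$ by at most $\epsilon n$ with probability at least $2/3$. 2. Its query complexity is $\tilde O\big((1/\epsilon)^{e^{\tilde O(\Delta/\epsilon)}}\big)$, uniformly in $\Delta\ge 1$ and $0<\epsilon\le 1/2$: there are functions $T(\Delta,\epsilon)$ and $Q(\Delta,\epsilon)$ with $T=\tilde O(\Delta/\epsilon)$ and $Q=\tilde O\big((1/\epsilon)^{e^{T}}\big)$ such that the algorithm makes at most $Q(\Delta,\epsilon)$ queries on every such $G$ and for every sample. Here $f=\tilde O(g)$ means $|f|\le K\,g\,(\log(2+g))^k$ for all $\Delta\ge1$ and $0<\epsilon\le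 1/2$, with constants $K$ and $k$. -/

import Mathlib

/-- The size of a maximum matching of the graph `G`. -/
noncomputable def maxMatchingSize {V : Type*} (G : SimpleGraph V) : ℕ :=
  sSup {k : ℕ | ∃ M : G.Subgraph, M.IsMatching ∧ M.edgeSet.ncard = k}

/-- The neighbor oracle of a graph: `nbr v i`, for `1 ≤ i ≤ deg v`, is the `i`-th neighbor of `v`,
the neighbors being listed in an arbitrary order and without repetition. -/
structure NeighborOracle {V : Type*} [Fintype V] (G : SimpleGraph V) [DecidableRel G.Adj] where
  nbr : V → ℕ → V
  bijOn : ∀ v, Set.BijOn (nbr v) (Set.Icc 1 (G.degree v)) (G.neighborSet v)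

/-- Deterministic programs which access a graph on the vertex set `V` only through
queries to the degree oracle and to the neighbor oracle (decision trees). -/
inductive QueryProg (V : Type*) (α : Type*)
  | pure (a : α) : QueryProg V α
  | askDegree (v : V) (next : ℕ → QueryProg V α) : QueryProg V α
  | askNeighbor (v : V) (i : ℕ) (next : V → QueryProg V α) : QueryProg V α

namespace QueryProg

/-- Sequential composition of programs. -/
def bind {V α β : Type*} : QueryProg V α → (α → QueryProg V β) → QueryProg V β
  | pure a, f => f a
  | askDegree v next, f => askDegree v fun d => (next d).bind f
  | askNeighbor v i next, f => askNeighbor v i fun t => (next t).bind f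

/-- The value that a program returns on a graph. -/
def output {V α : Type*} [Fintype V] {G : SimpleGraph V} [DecidableRel G.Adj]
    (O : NeighborOracle G) : QueryProg V α → α
  | pure a => a
  | askDegree v next => output O (next (G.degree v))
  | askNeighbor v i next => output O (next (O.nbr v i))

/-- The number of accesses to the two oracles that a program makes on a graph. -/
def queries {V α : Type*} [Fintype V] {G : SimpleGraph V} [DecidableRel G.Adj]
    (O : NeighborOracle G) : QueryProg V α → ℕ
  | pure _ => 0
  | askDegree v next => queries O (next (G.degree v)) + 1
  | askNeighbor v i next => queries O (next (O.nbr v i)) + 1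

/-- The loop that runs `f 1, …, f d` one after the other and returns the sum of the results. -/
noncomputable def sumLoop {V : Type*} (f : ℕ → QueryProg V ℝ) : ℕ → QueryProg V ℝ
  | 0 => pure 0
  | d + 1 => (sumLoop f d).bind fun a => (f (d + 1)).bind fun b => pure (a + b)

end QueryProg

/-- Depth-first search on the truncated path-tree. The current node of the path-tree is the simple
path consisting of `path` followed by `s`; the argument `k` is the number of levels which remain
below it. The result solves `x_u = 1 / (1 + lam * ∑ x_w)`, with `w` ranging over the children of
`u`, in the truncated tree (so `x_u = 1` at the last level). -/
noncomputable def dfs {V : Type*} [DecidableEq V] (lam : ℝ) : ℕ → List V → V → QueryProg V ℝ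
  | 0, _, _ => .pure 1
  | k + 1, path, s =>
    .askDegree s fun d =>
      (QueryProg.sumLoop
        (fun i => .askNeighbor s i fun t =>
          if t ∈ s :: path then .pure 0 else dfs lam k (s :: path) t) d).bind
        fun A => .pure (1 / (1 + lam * A))

/-- The loop `while |log x[h] - log x[h-1]| > ε / e do (h := h + 1; compute x[h])`, which returns
the last `x[h]`, where `x[h]` is computed by `dfs lam (h - 1) [] v`. The arguments `prev` and `cur`
are `x[h-1]` and `x[h]`. The first argument bounds the number of rounds. -/
noncomputable def marginalLoop {V : Type*} [DecidableEq V] (lam ε : ℝ) (v : V) :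
    ℕ → ℕ → ℝ → ℝ → QueryProg V ℝ
  | 0, _, _, cur => .pure cur
  | fuel + 1, h, prev, cur =>
    if |Real.log cur - Real.log prev| > ε / Real.exp 1 then
      (dfs lam h [] v).bind fun x => marginalLoop lam ε v fuel (h + 1) cur x
    else .pure cur

/-- Estimate of the probability that the vertex `v` is not covered by a random matching drawn with
probability proportional to `lam ^ |M|`. The bound `|V|` on the number of rounds of the loop never
takes effect: a simple path has at most `|V|` vertices, so `x[|V|] = x[|V| + 1]` and the loop,
which starts at `h = 2`, stops by its own test after at most `|V| - 1` rounds (if `|V| ≥ 1`). -/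
noncomputable def approxMarginal {V : Type*} [Fintype V] [DecidableEq V] (lam ε : ℝ) (v : V) :
    QueryProg V ℝ :=
  (dfs lam 0 [] v).bind fun x₁ => (dfs lam 1 [] v).bind fun x₂ =>
    marginalLoop lam ε v (Fintype.card V) 2 x₁ x₂

/-- The number of sampled vertices. -/
noncomputable def sampleSize (C ε : ℝ) : ℕ := ⌈C / ε ^ 2⌉₊

/-- The algorithm for the average size of a matching, as a program which depends on the random
sample `U` of `s` vertices: it returns `n / 2 - (n / (2 s)) * ∑ p̂(u)`, where `u` ranges over the
sample and `p̂(u)` is the estimate of the marginal at `u` with parameter `ε / 2`. -/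
noncomputable def approxMatchingStatistics {V : Type*} [Fintype V] [DecidableEq V] (lam ε : ℝ)
    {s : ℕ} (U : Fin s → V) : QueryProg V ℝ :=
  (QueryProg.sumLoop
    (fun i => if hi : i - 1 < s then approxMarginal lam (ε / 2) (U ⟨i - 1, hi⟩) else .pure 0)
    s).bind
    fun A => .pure ((Fintype.card V : ℝ) / 2 - (Fintype.card V : ℝ) / (2 * s) * A)

/-- The soft-O notation: `f = Õ(g)` on `S`, i.e. `|f| ≤ K g (log g) ^ k` on `S` for some constants
`K` and `k`; the logarithm is taken at `2 + g` to keep it away from zero. -/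
def IsSoftO {α : Type*} (S : Set α) (f g : α → ℝ) : Prop :=
  ∃ (K : ℝ) (k : ℕ), ∀ a ∈ S, |f a| ≤ K * g a * Real.log (2 + g a) ^ k

/-! Give a matching M the weight λ^|M|, and let p(v) be the probability that a random matching
misses v. Sorting matchings by the partner of v gives p(v) = 1/(1 + λ ∑ p(w)), with w ranging over
the neighbors of v and p(w) taken in G − v (`freeProb_eq`). Unrolled, this is the recursion on
simple paths. Truncations at even and odd depths bound p(v) from above and from below
(`pathMarginal_bounds`), so the difference tested by the loop certifies its own error. Each level
contracts logarithms by L/(1+L) with L = λΔ (`abs_log_one_div_sub_le`), so O(L²/ε) rounds suffice,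
and this gives the query bound.

The expected number of covered vertices is E = n − ∑ p(v), at most twice the maximum matching size
ν. Conversely, with r² = λ, a single maximum matching shows 2ν log r ≤ log Z_r, while convexity
gives log Z_r ≤ log Z_1 + E log r (`log_partitionFn_le`). Hence 2ν − E ≤ log Z_1 / log r when log r
> 0. The bound Z_1² ≤ ∏ (1 + deg v) (`partitionFn_one_sq_le`) turns this into 2ν − E ≤ (8/5)εn for Δ
≥ 2; the case Δ ≤ 1 is computed directly.

Approximate marginals cost another εn/5 and sampling, by Chebyshev, εn/5. The sum 2εn is halved by
the output formula. -/

section ApproxMatching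

open Finset

/-! ### Outputs and query counts of composed programs. -/

namespace QueryProg

variable {V α β : Type*} [Fintype V] {G : SimpleGraph V} [DecidableRel G.Adj]

theorem output_bind (O : NeighborOracle G) (p : QueryProg V α) (f : α → QueryProg V β) :
    (p.bind f).output O = (f (p.output O)).output O := by
  induction p with
  | pure a => rfl
  | askDegree v next ih => exact ih _
  | askNeighbor v i next ih => exact ih _

theorem queries_bind (O : NeighborOracle G) (p : QueryProg V α) (f : α → QueryProg V β) :
    (p.bind f).queries O = p.queries O + (f (p.output O)).queries O := by
  induction p with
  | pure a => simp [bind, queries, output]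
  | askDegree v next ih => simp only [bind, queries, output, ih]; ring
  | askNeighbor v i next ih => simp only [bind, queries, output, ih]; ring

theorem output_sumLoop (O : NeighborOracle G) (f : ℕ → QueryProg V ℝ) (d : ℕ) :
    (sumLoop f d).output O = ∑ i ∈ range d, (f (i + 1)).output O := by
  induction d with
  | zero => rfl
  | succ d ih => rw [sumLoop, output_bind, output_bind, sum_range_succ, ← ih]; rfl

theorem queries_sumLoop (O : NeighborOracle G) (f : ℕ → QueryProg V ℝ) (d : ℕ) :
    (sumLoop f d).queries O = ∑ i ∈ range d, (f (i + 1)).queries O := by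
  induction d with
  | zero => rfl
  | succ d ih => rw [sumLoop, queries_bind, queries_bind, sum_range_succ, ← ih]; rfl

end QueryProg

/-! ### The path-tree recursion computed by the search, and its cost. -/

section Semantics

theorem NeighborOracle.sum_range {V : Type*} [Fintype V] {G : SimpleGraph V}
    [DecidableRel G.Adj] (O : NeighborOracle G) (v : V) (f : V → ℝ) :
    ∑ i ∈ range (G.degree v), f (O.nbr v (i + 1)) = ∑ w ∈ G.neighborFinset v, f w := by
  have h := O.bijOn v
  refine sum_bij (fun i _ => O.nbr v (i + 1)) ?_ ?_ ?_ ?_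
  · intro i hi
    have := h.mapsTo (show i + 1 ∈ Set.Icc 1 (G.degree v) by simp at hi ⊢; omega)
    simpa using this
  · intro i hi j hj hij
    have := h.injOn (show i + 1 ∈ Set.Icc 1 (G.degree v) by simp at hi ⊢; omega)
      (show j + 1 ∈ Set.Icc 1 (G.degree v) by simp at hj ⊢; omega) hij
    omega
  · intro w hw
    obtain ⟨i, hi, rfl⟩ := h.surjOn (show w ∈ G.neighborSet v by simpa using hw)
    simp only [Set.mem_Icc] at hi
    exact ⟨i - 1, by simp; omega, by congr 1; omega⟩
  · intros; rfl

variable {V : Type*} [Fintype V] [DecidableEq V] {G : SimpleGraph V} [DecidableRel G.Adj]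

/-- The solution at the root `s` of the recursion `x_u = 1 / (1 + lam * ∑ x_w)` on the tree of
simple paths from `s` which avoid `S`, truncated after `k` steps. -/
noncomputable def pathMarginal (G : SimpleGraph V) [DecidableRel G.Adj] (lam : ℝ) :
    ℕ → Finset V → V → ℝ
  | 0, _, _ => 1
  | k + 1, S, s =>
    1 / (1 + lam * ∑ t ∈ G.neighborFinset s \ S, pathMarginal G lam k (insert s S) t)

theorem output_dfs (O : NeighborOracle G) (lam : ℝ) (k : ℕ) (path : List V) (s : V) :
    (dfs lam k path s).output O = pathMarginal G lam k path.toFinset s := by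
  induction k generalizing path s with
  | zero => rfl
  | succ k ih =>
    simp only [dfs, pathMarginal, QueryProg.output, QueryProg.output_bind,
      QueryProg.output_sumLoop]
    rw [O.sum_range s fun t => QueryProg.output O
      (if t ∈ s :: path then .pure 0 else dfs lam k (s :: path) t), sdiff_eq_filter, sum_filter]
    congr 3
    refine sum_congr rfl fun t ht => ?_
    have hts : t ≠ s := ((G.mem_neighborFinset s t).1 ht).ne'
    by_cases h : t ∈ path
    · simp [h, QueryProg.output]
    · simp [h, hts, ih]

/-- The `+ 1` absorbs the neighbor query leading to each child: with B bounding a child's cost plus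
that query, a node satisfies cost + 1 ≤ ΔB + 2 ≤ (2Δ + 2)B. -/
theorem queries_dfs_le (O : NeighborOracle G) {Δ : ℕ} (hΔ : ∀ v, G.degree v ≤ Δ) (lam : ℝ)
    (k : ℕ) (path : List V) (s : V) :
    (dfs lam k path s).queries O + 1 ≤ (2 * Δ + 2) ^ k := by
  induction k generalizing path s with
  | zero => simp [dfs, QueryProg.queries]
  | succ k ih =>
    simp only [dfs, QueryProg.queries, QueryProg.queries_bind, QueryProg.queries_sumLoop]
    have h1 : ∑ i ∈ range (G.degree s), (QueryProg.queries O
        (if O.nbr s (i + 1) ∈ s :: path then .pure 0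
          else dfs lam k (s :: path) (O.nbr s (i + 1))) + 1) ≤ Δ * (2 * Δ + 2) ^ k := by
      refine (sum_le_card_nsmul _ _ ((2 * Δ + 2) ^ k) fun i _ => ?_).trans ?_
      · split_ifs
        · simpa [QueryProg.queries] using Nat.one_le_pow _ _ (by omega)
        · exact ih _ _
      · rw [card_range, smul_eq_mul]
        exact Nat.mul_le_mul_right _ (hΔ s)
    have h2 : 1 ≤ (2 * Δ + 2) ^ k := Nat.one_le_pow _ _ (by omega)
    rw [pow_succ]
    nlinarith

/-- The value x^{[h]} is `pathMarginal` at depth h − 1, whence the shift by 2. Running out of fuel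
is kept as an alternative; it is harmless because depth |V| is already exact
(`pathMarginal_eq_freeProb`). -/
theorem output_marginalLoop (O : NeighborOracle G) (lam ε : ℝ) (v : V) (fuel j : ℕ) :
    ∃ k, (marginalLoop lam ε v fuel (j + 2) (pathMarginal G lam j ∅ v)
        (pathMarginal G lam (j + 1) ∅ v)).output O = pathMarginal G lam (k + 1) ∅ v ∧
      (|Real.log (pathMarginal G lam (k + 1) ∅ v) - Real.log (pathMarginal G lam k ∅ v)|
        ≤ ε / Real.exp 1 ∨ k = j + fuel) := by
  induction fuel generalizing j with
  | zero => exact ⟨j, rfl, Or.inr rfl⟩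
  | succ fuel ih =>
    rw [marginalLoop]
    split_ifs with h
    · rw [QueryProg.output_bind, output_dfs]
      obtain ⟨k, h1, h2⟩ := ih (j + 1)
      exact ⟨k, h1, h2.imp_right fun h => by omega⟩
    · exact ⟨j, rfl, Or.inl (not_lt.1 h)⟩

/-- From depth `H` on the stopping test always succeeds, so at most `H - j` further searches are
run. -/
theorem queries_marginalLoop_le (O : NeighborOracle G) (lam ε : ℝ) (v : V) {H B : ℕ}
    (hH : ∀ k, H ≤ k →
      |Real.log (pathMarginal G lam (k + 1) ∅ v) - Real.log (pathMarginal G lam k ∅ v)|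
        ≤ ε / Real.exp 1)
    (hB : ∀ k, k < H → (dfs lam (k + 2) [] v).queries O ≤ B) (fuel j : ℕ) :
    (marginalLoop lam ε v fuel (j + 2) (pathMarginal G lam j ∅ v)
        (pathMarginal G lam (j + 1) ∅ v)).queries O ≤ (H - j) * B := by
  induction fuel generalizing j with
  | zero => exact Nat.zero_le _
  | succ fuel ih =>
    rw [marginalLoop]
    split_ifs with h
    · have hj : j < H := not_le.1 fun hj => absurd (hH j hj) (not_le.2 h)
      rw [QueryProg.queries_bind, output_dfs]
      obtain ⟨m, hm⟩ : ∃ m, H - j = m + 1 := ⟨H - j - 1, by omega⟩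
      have := ih (j + 1)
      rw [show H - (j + 1) = m by omega] at this
      rw [hm, add_mul, one_mul, add_comm]
      exact add_le_add this (hB j hj)
    · exact Nat.zero_le _

theorem output_approxMarginal (O : NeighborOracle G) (lam ε : ℝ) (v : V) :
    ∃ k, (approxMarginal lam ε v).output O = pathMarginal G lam (k + 1) ∅ v ∧
      (|Real.log (pathMarginal G lam (k + 1) ∅ v) - Real.log (pathMarginal G lam k ∅ v)|
        ≤ ε / Real.exp 1 ∨ k = Fintype.card V) := by
  rw [approxMarginal, QueryProg.output_bind, QueryProg.output_bind, output_dfs, output_dfs]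
  simpa using output_marginalLoop O lam ε v (Fintype.card V) 0

theorem queries_approxMarginal_le (O : NeighborOracle G) {Δ : ℕ} (hΔ : ∀ v, G.degree v ≤ Δ)
    (lam ε : ℝ) (v : V) {H : ℕ}
    (hH : ∀ k, H ≤ k →
      |Real.log (pathMarginal G lam (k + 1) ∅ v) - Real.log (pathMarginal G lam k ∅ v)|
        ≤ ε / Real.exp 1) :
    (approxMarginal lam ε v).queries O ≤ (H + 1) * (2 * Δ + 2) ^ (H + 1) := by
  have hB : ∀ k, k ≤ H → (dfs lam (k + 1) [] v).queries O ≤ (2 * Δ + 2) ^ (H + 1) := fun k hk =>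
    (Nat.le_of_succ_le (queries_dfs_le O hΔ lam (k + 1) [] v)).trans
      (Nat.pow_le_pow_right (by omega) (by omega))
  have h := queries_marginalLoop_le O lam ε v hH (fun k hk => hB (k + 1) hk) (Fintype.card V) 0
  rw [approxMarginal, QueryProg.queries_bind, QueryProg.queries_bind, output_dfs, output_dfs]
  have h1 := hB 0 (Nat.zero_le _)
  have h0 : (dfs lam 0 [] v).queries O = 0 := rfl
  simp only [List.toFinset_nil, zero_add, Nat.sub_zero] at h h1 ⊢
  rw [h0, add_mul]
  omega

theorem output_approxMatchingStatistics (O : NeighborOracle G) (lam ε : ℝ) {s : ℕ}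
    (U : Fin s → V) :
    (approxMatchingStatistics lam ε U).output O = (Fintype.card V : ℝ) / 2 -
      (Fintype.card V : ℝ) / (2 * s) *
        ∑ j, (approxMarginal lam (ε / 2) (U j)).output O := by
  rw [approxMatchingStatistics, QueryProg.output_bind, QueryProg.output_sumLoop,
    ← Fin.sum_univ_eq_sum_range (fun i => QueryProg.output O (if hi : i + 1 - 1 < s then
      approxMarginal lam (ε / 2) (U ⟨i + 1 - 1, hi⟩) else .pure 0))]
  simp [QueryProg.output]

theorem queries_approxMatchingStatistics_le (O : NeighborOracle G) (lam ε : ℝ) {s : ℕ}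
    (U : Fin s → V) {B : ℕ} (hB : ∀ v, (approxMarginal lam (ε / 2) v).queries O ≤ B) :
    (approxMatchingStatistics lam ε U).queries O ≤ s * B := by
  rw [approxMatchingStatistics, QueryProg.queries_bind, QueryProg.queries_sumLoop]
  refine (sum_le_card_nsmul (range s) _ B fun i _ => ?_).trans (by simp)
  split_ifs
  · exact hB _
  · exact Nat.zero_le _

end Semantics

/-! ### The monomer-dimer partition function and the alternating bounds on its marginals. -/

section Partition

theorem disjoint_swap_of_fixed {V : Type*} [DecidableEq V] {f : Equiv.Perm V} {v w : V} (hv : f v = v) (hw : f w = w) :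
    f.Disjoint (Equiv.swap v w) := by
  intro x
  by_cases h1 : x = v
  · exact Or.inl (h1 ▸ hv)
  by_cases h2 : x = w
  · exact Or.inl (h2 ▸ hw)
  exact Or.inr (Equiv.swap_apply_of_ne_of_ne h1 h2)

variable {V : Type*} [Fintype V] [DecidableEq V] (G : SimpleGraph V) [DecidableRel G.Adj]

/-- The matchings of `G - S`, as involutions which exchange matched vertices and fix the other
vertices. -/
def matchingPerms (S : Finset V) : Finset (Equiv.Perm V) :=
  {f | (∀ v, f (f v) = v) ∧ (∀ v, f v ≠ v → G.Adj v (f v)) ∧ ∀ v ∈ S, f v = v}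

/-- The partition function of the monomer-dimer model on `G - S` with edge weight `r ^ 2`. -/
noncomputable def partitionFn (r : ℝ) (S : Finset V) : ℝ :=
  ∑ f ∈ matchingPerms G S, r ^ #f.support

/-- The probability that `v` is not covered by a random matching of `G - S`. -/
noncomputable def freeProb (r : ℝ) (S : Finset V) (v : V) : ℝ :=
  partitionFn G r (insert v S) / partitionFn G r S

variable {G}

theorem mem_matchingPerms {S : Finset V} {f : Equiv.Perm V} : f ∈ matchingPerms G S ↔
    (∀ v, f (f v) = v) ∧ (∀ v, f v ≠ v → G.Adj v (f v)) ∧ ∀ v ∈ S, f v = v := by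
  simp [matchingPerms]

theorem one_mem_matchingPerms (S : Finset V) : 1 ∈ matchingPerms G S := by
  simp [mem_matchingPerms]

theorem filter_matchingPerms_fixed (S : Finset V) (v : V) :
    {f ∈ matchingPerms G S | f v = v} = matchingPerms G (insert v S) := by
  ext f
  simp only [mem_filter, mem_matchingPerms, forall_mem_insert]
  tauto

theorem partitionFn_pos {r : ℝ} (hr : 0 < r) (S : Finset V) : 0 < partitionFn G r S :=
  sum_pos (fun _ _ => pow_pos hr _) ⟨1, one_mem_matchingPerms S⟩

theorem partitionFn_univ (r : ℝ) : partitionFn G r univ = 1 := by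
  have : matchingPerms G univ = {1} := by
    ext f
    rw [mem_singleton]
    refine ⟨fun hf => Equiv.ext fun v => (mem_matchingPerms.1 hf).2.2 v (mem_univ v), ?_⟩
    rintro rfl
    exact one_mem_matchingPerms _
  simp [partitionFn, this]

theorem mul_swap_mem_matchingPerms {S : Finset V} {f : Equiv.Perm V} {v w : V}
    (hvw : G.Adj v w) (hv : v ∉ S) (hw : w ∉ S)
    (hf : f ∈ matchingPerms G (insert w (insert v S))) :
    f * Equiv.swap v w ∈ matchingPerms G S := by
  obtain ⟨h1, h2, h3⟩ := mem_matchingPerms.1 hf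
  simp only [forall_mem_insert] at h3
  obtain ⟨hfw, hfv, h3⟩ := h3
  have key : ∀ x, x ≠ v → x ≠ w → (f * Equiv.swap v w) x = f x := fun x a b => by
    rw [Equiv.Perm.mul_apply, Equiv.swap_apply_of_ne_of_ne a b]
  have kv : (f * Equiv.swap v w) v = w := by simp [hfw]
  have kw : (f * Equiv.swap v w) w = v := by simp [hfv]
  refine mem_matchingPerms.2 ⟨fun x => ?_, fun x => ?_, fun x hx => ?_⟩
  · by_cases a : x = v
    · rw [a, kv, kw]
    by_cases b : x = w
    · rw [b, kw, kv]
    rw [key x a b, key (f x), h1]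
    · intro h; exact a (f.injective (h.trans hfv.symm))
    · intro h; exact b (f.injective (h.trans hfw.symm))
  · by_cases a : x = v
    · rw [a, kv]; exact fun _ => hvw
    by_cases b : x = w
    · rw [b, kw]; exact fun _ => hvw.symm
    rw [key x a b]; exact h2 x
  · rw [key x (fun h => hv (h ▸ hx)) (fun h => hw (h ▸ hx))]
    exact h3 x hx

theorem mul_swap_mem_matchingPerms_insert {S : Finset V} {f : Equiv.Perm V} {v w : V}
    (hvw : v ≠ w) (hf : f ∈ matchingPerms G S) (hfv : f v = w) :
    f * Equiv.swap v w ∈ matchingPerms G (insert w (insert v S)) := by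
  obtain ⟨h1, h2, h3⟩ := mem_matchingPerms.1 hf
  have hfw : f w = v := by rw [← hfv, h1]
  have key : ∀ x, x ≠ v → x ≠ w → (f * Equiv.swap v w) x = f x := fun x a b => by
    rw [Equiv.Perm.mul_apply, Equiv.swap_apply_of_ne_of_ne a b]
  have kv : (f * Equiv.swap v w) v = v := by simp [hfw]
  have kw : (f * Equiv.swap v w) w = w := by simp [hfv]
  refine mem_matchingPerms.2 ⟨fun x => ?_, fun x => ?_, ?_⟩
  · by_cases a : x = v
    · rw [a, kv, kv]
    by_cases b : x = w
    · rw [b, kw, kw]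
    rw [key x a b, key (f x), h1]
    · intro h; exact b (f.injective (h.trans hfw.symm))
    · intro h; exact a (f.injective (h.trans hfv.symm))
  · by_cases a : x = v
    · rw [a, kv]; exact fun h => absurd rfl h
    by_cases b : x = w
    · rw [b, kw]; exact fun h => absurd rfl h
    rw [key x a b]; exact h2 x
  · simp only [forall_mem_insert]
    refine ⟨kw, kv, fun x hx => ?_⟩
    have hfx := h3 x hx
    rw [key x, hfx]
    · rintro rfl; exact hvw (hfx.symm.trans hfv)
    · rintro rfl; exact hvw (hfw.symm.trans hfx)

/-- Right multiplication by the transposition of v and w deletes or restores the edge vw; the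
support changes by two points, hence the factor r². -/
theorem sum_matchingPerms_matched (r : ℝ) {S : Finset V} {v w : V} (hvw : G.Adj v w)
    (hv : v ∉ S) (hw : w ∉ S) :
    ∑ f ∈ matchingPerms G S with f v = w, r ^ #f.support
      = r ^ 2 * partitionFn G r (insert w (insert v S)) := by
  rw [partitionFn, mul_sum]
  have hsq : ∀ f : Equiv.Perm V, f * Equiv.swap v w * Equiv.swap v w = f := fun f => by
    rw [mul_assoc, Equiv.swap_mul_self, mul_one]
  symm
  refine sum_bij' (fun f _ => f * Equiv.swap v w) (fun f _ => f * Equiv.swap v w) ?_ ?_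
    (fun f _ => hsq f) (fun f _ => hsq f) ?_
  · intro f hf
    have h3 := (mem_matchingPerms.1 hf).2.2
    simp only [forall_mem_insert] at h3
    exact mem_filter.2 ⟨mul_swap_mem_matchingPerms hvw hv hw hf, by simp [h3.1]⟩
  · intro f hf
    obtain ⟨hf, hfv⟩ := mem_filter.1 hf
    exact mul_swap_mem_matchingPerms_insert hvw.ne hf hfv
  · intro f hf
    have h3 := (mem_matchingPerms.1 hf).2.2
    simp only [forall_mem_insert] at h3
    rw [(disjoint_swap_of_fixed h3.2.1 h3.1).card_support_mul, Equiv.Perm.card_support_swap hvw.ne]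
    ring

/-- Matchings are sorted by the image of v: v itself if uncovered, otherwise its partner, which is a
neighbor outside S. -/
theorem partitionFn_eq (r : ℝ) {S : Finset V} {v : V} (hv : v ∉ S) :
    partitionFn G r S = partitionFn G r (insert v S) +
      r ^ 2 * ∑ w ∈ G.neighborFinset v \ S, partitionFn G r (insert w (insert v S)) := by
  have h := sum_fiberwise (matchingPerms G S) (fun f : Equiv.Perm V => f v)
    (fun f => r ^ #f.support)
  rw [← add_sum_erase univ _ (mem_univ v), filter_matchingPerms_fixed] at h
  rw [partitionFn, ← h, mul_sum]
  refine congrArg _ (Eq.symm ?_)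
  refine (sum_congr rfl fun w hw => ?_).trans (sum_subset (fun w (hw : w ∈ _ \ S) => ?_)
    fun w hw hw2 => ?_)
  · rw [mem_sdiff, SimpleGraph.mem_neighborFinset] at hw
    exact (sum_matchingPerms_matched r hw.1 hv hw.2).symm
  · rw [mem_sdiff, SimpleGraph.mem_neighborFinset] at hw
    simpa using hw.1.ne'
  · refine sum_eq_zero fun f hf => absurd ?_ hw2
    obtain ⟨hfS, rfl⟩ := mem_filter.1 hf
    obtain ⟨h1, h2, h3⟩ := mem_matchingPerms.1 hfS
    have hne : f v ≠ v := (mem_erase.1 hw).1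
    rw [mem_sdiff, SimpleGraph.mem_neighborFinset]
    refine ⟨h2 v hne, fun hS => hne ?_⟩
    have := h3 _ hS
    rw [h1] at this
    exact this.symm

theorem freeProb_pos {r : ℝ} (hr : 0 < r) (S : Finset V) (v : V) : 0 < freeProb G r S v :=
  div_pos (partitionFn_pos hr _) (partitionFn_pos hr _)

theorem freeProb_eq {r : ℝ} (hr : 0 < r) {S : Finset V} {v : V} (hv : v ∉ S) :
    freeProb G r S v =
      1 / (1 + r ^ 2 * ∑ w ∈ G.neighborFinset v \ S, freeProb G r (insert v S) w) := by
  have h0 := partitionFn_pos (G := G) hr (insert v S)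
  simp only [freeProb]
  rw [← sum_div, partitionFn_eq r hv]
  field_simp

theorem freeProb_le_one {r : ℝ} (hr : 0 < r) {S : Finset V} {v : V} (hv : v ∉ S) :
    freeProb G r S v ≤ 1 := by
  rw [freeProb_eq hr hv, div_le_one]
  · exact le_add_of_nonneg_right (mul_nonneg (by positivity)
      (sum_nonneg fun w _ => (freeProb_pos hr _ _).le))
  · have := sum_nonneg fun w (_ : w ∈ G.neighborFinset v \ S) =>
      (freeProb_pos (G := G) hr (insert v S) w).le
    positivity

theorem not_mem_insert_of_mem_neighborFinset_sdiff {S : Finset V} {v w : V}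
    (hw : w ∈ G.neighborFinset v \ S) : w ∉ insert v S := by
  rw [mem_sdiff, SimpleGraph.mem_neighborFinset] at hw
  rw [mem_insert, not_or]
  exact ⟨hw.1.ne', hw.2⟩

section

variable {lam : ℝ}

theorem pathMarginal_pos (hl : 0 ≤ lam) (k : ℕ) (S : Finset V) (v : V) :
    0 < pathMarginal G lam k S v := by
  induction k generalizing S v with
  | zero => exact one_pos
  | succ k ih =>
    rw [pathMarginal]
    have := sum_nonneg fun w (_ : w ∈ G.neighborFinset v \ S) => (ih (insert v S) w).le
    positivity

theorem pathMarginal_le_one (hl : 0 ≤ lam) (k : ℕ) (S : Finset V) (v : V) :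
    pathMarginal G lam k S v ≤ 1 := by
  cases k with
  | zero => exact le_rfl
  | succ k =>
    rw [pathMarginal]
    have := sum_nonneg fun w (_ : w ∈ G.neighborFinset v \ S) =>
      (pathMarginal_pos (G := G) hl k (insert v S) w).le
    rw [div_le_one (by positivity)]
    exact le_add_of_nonneg_right (by positivity)

end

/-- Each step enlarges S by one vertex, so the truncation level is never reached: there S would be
all of V, yet v ∉ S. -/
theorem pathMarginal_eq_freeProb {r : ℝ} (hr : 0 < r) (k : ℕ) {S : Finset V} {v : V} (hv : v ∉ S)
    (hk : Fintype.card V ≤ #S + k) : pathMarginal G (r ^ 2) k S v = freeProb G r S v := by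
  induction k generalizing S v with
  | zero =>
    exact absurd (mem_univ v) (by rwa [← eq_univ_of_card S (le_antisymm (card_le_univ S) hk)])
  | succ k ih =>
    rw [pathMarginal, freeProb_eq hr hv]
    congr 3
    refine sum_congr rfl fun w hw => ih (not_mem_insert_of_mem_neighborFinset_sdiff hw) ?_
    rw [card_insert_of_notMem hv]
    omega

/-- The recursion is decreasing in the values of the children, so every level reverses the
inequality; depth 0 starts from p ≤ 1. -/
theorem pathMarginal_bounds {r : ℝ} (hr : 0 < r) (j : ℕ) {S : Finset V} {v : V} (hv : v ∉ S) :
    freeProb G r S v ≤ pathMarginal G (r ^ 2) (2 * j) S v ∧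
      pathMarginal G (r ^ 2) (2 * j + 1) S v ≤ freeProb G r S v := by
  have step : ∀ {S : Finset V} {v : V}, v ∉ S → ∀ {k : ℕ},
      (∀ {S : Finset V} {v : V}, v ∉ S → freeProb G r S v ≤ pathMarginal G (r ^ 2) k S v) →
      pathMarginal G (r ^ 2) (k + 1) S v ≤ freeProb G r S v := by
    intro S v hv k h
    rw [pathMarginal, freeProb_eq hr hv]
    have := sum_nonneg fun w (_ : w ∈ G.neighborFinset v \ S) =>
      (freeProb_pos (G := G) hr (insert v S) w).le
    gcongr with w hw
    exact h (not_mem_insert_of_mem_neighborFinset_sdiff hw)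
  have step' : ∀ {S : Finset V} {v : V}, v ∉ S → ∀ {k : ℕ},
      (∀ {S : Finset V} {v : V}, v ∉ S → pathMarginal G (r ^ 2) k S v ≤ freeProb G r S v) →
      freeProb G r S v ≤ pathMarginal G (r ^ 2) (k + 1) S v := by
    intro S v hv k h
    rw [pathMarginal, freeProb_eq hr hv]
    have := sum_nonneg fun w (_ : w ∈ G.neighborFinset v \ S) =>
      (pathMarginal_pos (G := G) (sq_nonneg r) k (insert v S) w).le
    gcongr with w hw
    exact h (not_mem_insert_of_mem_neighborFinset_sdiff hw)
  have key : ∀ j {S : Finset V} {v : V}, v ∉ S →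
      freeProb G r S v ≤ pathMarginal G (r ^ 2) (2 * j) S v := by
    intro j
    induction j with
    | zero => exact fun hv => freeProb_le_one hr hv
    | succ j ih => exact fun hv => step' hv (k := 2 * j + 1) (fun hv => step hv ih)
  exact ⟨key j hv, step hv (key j)⟩

/-- The true marginal lies between two consecutive truncations. -/
theorem abs_log_pathMarginal_sub_le {r : ℝ} (hr : 0 < r) (k : ℕ) {S : Finset V} {v : V}
    (hv : v ∉ S) :
    |Real.log (pathMarginal G (r ^ 2) (k + 1) S v) - Real.log (freeProb G r S v)| ≤
      |Real.log (pathMarginal G (r ^ 2) (k + 1) S v) -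
        Real.log (pathMarginal G (r ^ 2) k S v)| := by
  have hp := freeProb_pos (G := G) hr S v
  have hy := fun k => pathMarginal_pos (G := G) (sq_nonneg r) k S v
  obtain ⟨j, rfl | rfl⟩ := k.even_or_odd'
  · obtain ⟨h1, h2⟩ := pathMarginal_bounds (G := G) hr j hv
    have a1 := Real.log_le_log hp h1
    have a2 := Real.log_le_log (hy _) h2
    rw [abs_of_nonpos (by linarith), abs_of_nonpos (by linarith)]
    linarith
  · have h1 := (pathMarginal_bounds (G := G) hr (j + 1) hv).1
    have h2 := (pathMarginal_bounds (G := G) hr j hv).2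
    have a1 := Real.log_le_log hp h1
    have a2 := Real.log_le_log (hy _) h2
    rw [show 2 * j + 1 + 1 = 2 * (j + 1) by ring, abs_of_nonneg (by linarith),
      abs_of_nonneg (by linarith)]
    linarith

/-- The logarithm has slope at least 1 on (0, 1]. -/
theorem abs_sub_le_abs_log_sub_log {x y : ℝ} (hx : 0 < x) (hy : 0 < y) (hx1 : x ≤ 1)
    (hy1 : y ≤ 1) : |x - y| ≤ |Real.log x - Real.log y| := by
  wlog h : y ≤ x generalizing x y
  · rw [abs_sub_comm, abs_sub_comm (Real.log x)]
    exact this hy hx hy1 hx1 (not_le.1 h).le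
  have h1 := Real.log_le_log hy h
  rw [abs_of_nonneg (sub_nonneg.2 h), abs_of_nonneg (sub_nonneg.2 h1)]
  have h2 := Real.log_le_sub_one_of_pos (div_pos hy hx)
  rw [Real.log_div hy.ne' hx.ne'] at h2
  have h3 : x - y ≤ 1 - y / x := by
    rw [one_sub_div hx.ne', le_div_iff₀ hx]
    nlinarith
  linarith

/-- The estimate of `approxMarginal` is a number of `(0, 1]` at distance at most `ε / e` from the
probability that `v` is not covered. -/
theorem approxMarginal_spec (O : NeighborOracle G) {r ε : ℝ} (hr : 0 < r) (hε : 0 < ε) (v : V) :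
    0 < (approxMarginal (r ^ 2) ε v).output O ∧ (approxMarginal (r ^ 2) ε v).output O ≤ 1 ∧
      |(approxMarginal (r ^ 2) ε v).output O - freeProb G r ∅ v| ≤ ε / Real.exp 1 := by
  obtain ⟨k, hk, h⟩ := output_approxMarginal O (r ^ 2) ε v
  have hv : v ∉ (∅ : Finset V) := notMem_empty v
  have h0 := pathMarginal_pos (G := G) (sq_nonneg r) (k + 1) ∅ v
  have h1 := pathMarginal_le_one (G := G) (sq_nonneg r) (k + 1) ∅ v
  rw [hk]
  refine ⟨h0, h1, ?_⟩
  obtain h | rfl := h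
  · exact (abs_sub_le_abs_log_sub_log h0 (freeProb_pos hr _ _) h1 (freeProb_le_one hr hv)).trans
      ((abs_log_pathMarginal_sub_le hr k hv).trans h)
  · rw [pathMarginal_eq_freeProb hr _ hv (by simp), sub_self, abs_zero]
    positivity

end Partition

/-! ### Correlation decay and the number of rounds. -/

section Contraction

/-- As a function of log A, log(1 + A) has slope A/(1 + A) ≤ L/(1 + L). The multiplicative
hypotheses also allow A or B to vanish, as happens at a node without children. -/
theorem abs_log_one_div_sub_le {A B D L : ℝ} (hA : 0 ≤ A) (hB : 0 ≤ B) (hAL : A ≤ L) (hBL : B ≤ L)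
    (hD : 0 ≤ D) (hAB : A ≤ Real.exp D * B) (hBA : B ≤ Real.exp D * A) :
    |Real.log (1 / (1 + A)) - Real.log (1 / (1 + B))| ≤ L / (1 + L) * D := by
  wlog h : A ≤ B generalizing A B
  · rw [abs_sub_comm]
    exact this hB hA hBL hAL hBA hAB (not_le.1 h).le
  have hA1 : 0 < 1 + A := by linarith
  have hB1 : 0 < 1 + B := by linarith
  have hlog := Real.log_le_log hA1 (add_le_add_right h 1)
  rw [one_div, one_div, Real.log_inv, Real.log_inv, neg_sub_neg, abs_of_nonneg (by linarith)]
  have hφ : B / (1 + B) ≤ L / (1 + L) := by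
    rw [div_le_div_iff₀ hB1 (by linarith)]
    nlinarith
  refine le_trans ?_ (mul_le_mul_of_nonneg_right hφ hD)
  -- Convexity of exp at 0 and −D with weights 1/(1+B) and B/(1+B) yields exp(−D·B/(1+B)) ≤
  -- (1+A)/(1+B), because A ≥ B·exp(−D).
  have hconv := convexOn_exp.2 (Set.mem_univ 0) (Set.mem_univ (-D))
    (show 0 ≤ 1 / (1 + B) by positivity) (show 0 ≤ B / (1 + B) by positivity)
    (by field_simp)
  simp only [smul_eq_mul, mul_zero, zero_add, Real.exp_zero, mul_one] at hconv
  have h1 : B * Real.exp (-D) ≤ A := by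
    rw [Real.exp_neg, ← div_eq_mul_inv, div_le_iff₀ (Real.exp_pos D), mul_comm]
    exact hBA
  have h2 : 1 / (1 + B) + B / (1 + B) * Real.exp (-D) ≤ (1 + A) / (1 + B) := by
    rw [div_mul_eq_mul_div, ← add_div]
    gcongr
  have h3 := Real.log_le_log (Real.exp_pos _) (hconv.trans h2)
  rw [Real.log_exp, Real.log_div hA1.ne' hB1.ne'] at h3
  linarith

variable {V : Type*} [Fintype V] [DecidableEq V] {G : SimpleGraph V} [DecidableRel G.Adj]

theorem mul_sum_pathMarginal_le {Δ : ℕ} (hΔ : ∀ v, G.degree v ≤ Δ) {lam : ℝ} (hl : 0 ≤ lam)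
    (k : ℕ) (S T : Finset V) (v : V) :
    lam * ∑ w ∈ G.neighborFinset v \ S, pathMarginal G lam k T w ≤ lam * Δ := by
  refine mul_le_mul_of_nonneg_left ?_ hl
  refine (sum_le_card_nsmul _ _ 1 fun w _ => pathMarginal_le_one hl k T w).trans ?_
  rw [nsmul_eq_mul, mul_one, Nat.cast_le]
  exact (card_le_card sdiff_subset).trans (by simpa using hΔ v)

/-- Correlation decay: every level of the recursion contracts the logarithm of its value. -/
theorem abs_log_pathMarginal_succ_sub_le {Δ : ℕ} (hΔ : ∀ v, G.degree v ≤ Δ) {lam : ℝ}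
    (hl : 0 ≤ lam) (k : ℕ) (S : Finset V) (v : V) :
    |Real.log (pathMarginal G lam (k + 1) S v) - Real.log (pathMarginal G lam k S v)| ≤
      (lam * Δ / (1 + lam * Δ)) ^ k * Real.log (1 + lam * Δ) := by
  have hL : 0 ≤ lam * Δ := by positivity
  have hlog : 0 ≤ Real.log (1 + lam * Δ) := Real.log_nonneg (by linarith)
  have hsum : ∀ k (S T : Finset V) v,
      0 ≤ lam * ∑ w ∈ G.neighborFinset v \ S, pathMarginal G lam k T w := fun k S T v =>
    mul_nonneg hl (sum_nonneg fun w _ => (pathMarginal_pos hl k T w).le)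
  induction k generalizing S v with
  | zero =>
    have h1 := mul_sum_pathMarginal_le hΔ hl 0 S (insert v S) v
    have h0 := hsum 0 S (insert v S) v
    rw [pow_zero, one_mul, show pathMarginal G lam 0 S v = 1 from rfl, Real.log_one, sub_zero,
      pathMarginal, one_div, Real.log_inv, abs_neg, abs_of_nonneg (Real.log_nonneg (by linarith))]
    exact Real.log_le_log (by linarith) (by linarith)
  | succ k ih =>
    rw [pow_succ', mul_assoc]
    set D := (lam * Δ / (1 + lam * Δ)) ^ k * Real.log (1 + lam * Δ) with hD
    have hcomp : ∀ a b : ℝ, 0 < a → 0 < b → Real.log a - Real.log b ≤ D →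
        a ≤ Real.exp D * b := by
      intro a b ha hb hab
      rw [← Real.log_le_log_iff ha (by positivity), Real.log_mul (Real.exp_pos D).ne' hb.ne',
        Real.log_exp]
      linarith
    have hpos := fun k => pathMarginal_pos (G := G) hl k
    rw [pathMarginal, pathMarginal]
    refine abs_log_one_div_sub_le (hsum _ _ _ _) (hsum _ _ _ _)
      (mul_sum_pathMarginal_le hΔ hl _ _ _ _) (mul_sum_pathMarginal_le hΔ hl _ _ _ _)
      (by positivity) ?_ ?_
    · rw [mul_left_comm]
      refine mul_le_mul_of_nonneg_left ?_ hl
      rw [mul_sum]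
      exact sum_le_sum fun w _ => hcomp _ _ (hpos _ _ _) (hpos _ _ _) (abs_le.1 (ih _ _)).2
    · rw [mul_left_comm]
      refine mul_le_mul_of_nonneg_left ?_ hl
      rw [mul_sum]
      exact sum_le_sum fun w _ => hcomp _ _ (hpos _ _ _) (hpos _ _ _)
        (by linarith [(abs_le.1 (ih (insert v S) w)).1])

/-- Bernoulli gives (1 + 1/L)^k ≥ k/L, so the product is at most L²/k ≤ ε/6, and e < 3. -/
theorem pow_mul_log_le {L ε : ℝ} (hL : 0 < L) (hε : 0 < ε) {k : ℕ} (hk : 6 * L ^ 2 / ε ≤ k) :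
    (L / (1 + L)) ^ k * Real.log (1 + L) ≤ ε / 2 / Real.exp 1 := by
  have hk0 : (0 : ℝ) < k := lt_of_lt_of_le (by positivity) hk
  have h1 : (L / (1 + L)) ^ k ≤ L / k := by
    have hb := one_add_mul_le_pow (show (-2 : ℝ) ≤ 1 / L by
      have := one_div_pos.2 hL; linarith) k
    have h2 : (L / (1 + L)) ^ k = ((1 + 1 / L) ^ k)⁻¹ := by
      rw [← inv_pow]
      congr 1
      field_simp
      ring
    rw [h2, inv_le_comm₀ (by positivity) (by positivity), inv_div]
    have : (k : ℝ) * (1 / L) = k / L := by ring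
    linarith
  have h2 : Real.log (1 + L) ≤ L := by
    have := Real.log_le_sub_one_of_pos (show 0 < 1 + L by linarith)
    linarith
  have h3 : L ^ 2 / k ≤ ε / 6 := by
    rw [div_le_iff₀ hε] at hk
    rw [div_le_div_iff₀ hk0 (by norm_num)]
    linarith
  have h4 : ε / 6 ≤ ε / 2 / Real.exp 1 := by
    rw [div_div]
    gcongr
    linarith [Real.exp_one_lt_d9]
  calc (L / (1 + L)) ^ k * Real.log (1 + L) ≤ L / k * L :=
        mul_le_mul h1 h2 (Real.log_nonneg (by linarith)) (by positivity)
    _ = L ^ 2 / k := by ring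
    _ ≤ _ := h3.trans h4

end Contraction

/-! ### Expected number of covered vertices against the maximum. -/

section Matching

/-- The left side consists of the two top-degree parts of the expansion of the right side. -/
theorem prod_add_sum_prod_erase_le {ι : Type*} [DecidableEq ι] (s : Finset ι) {d : ι → ℝ}
    (hd : ∀ i, 0 ≤ d i) :
    ∏ i ∈ s, d i + ∑ u ∈ s, ∏ i ∈ s.erase u, d i ≤ ∏ i ∈ s, (1 + d i) := by
  induction s using Finset.induction_on with
  | empty => simp
  | insert a s ha ih =>
    have h : ∑ u ∈ s, ∏ i ∈ (insert a s).erase u, d i = d a * ∑ u ∈ s, ∏ i ∈ s.erase u, d i := by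
      rw [mul_sum]
      refine sum_congr rfl fun u hu => ?_
      have hau : a ≠ u := fun h => ha (h ▸ hu)
      rw [erase_insert_of_ne hau, prod_insert fun h => ha (mem_of_mem_erase h)]
    rw [prod_insert ha, prod_insert ha, sum_insert ha, erase_insert ha, h]
    have h1 : 0 ≤ ∑ u ∈ s, ∏ i ∈ s.erase u, d i := sum_nonneg fun u _ => prod_nonneg fun i _ => hd i
    nlinarith [hd a, mul_le_mul_of_nonneg_left ih (hd a)]

variable {V : Type*} [Fintype V] [DecidableEq V] {G : SimpleGraph V} [DecidableRel G.Adj]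

theorem partitionFn_eq_sum_insert {S : Finset V} {v : V} (hv : v ∉ S) :
    partitionFn G 1 S =
      ∑ u ∈ insert v (G.neighborFinset v \ S), partitionFn G 1 (insert u (insert v S)) := by
  rw [partitionFn_eq 1 hv, sum_insert (by simp), insert_idem, one_pow, one_mul]

/-- The square of the number of matchings is at most the product of the numbers `1 + deg v`. -/
theorem partitionFn_one_sq_le (S : Finset V) :
    partitionFn G 1 S ^ 2 ≤ ∏ x ∈ Sᶜ, (1 + (#(G.neighborFinset x \ S) : ℝ)) := by
  induction hn : #Sᶜ using Nat.strong_induction_on generalizing S with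
  | _ n ih =>
    obtain hS | ⟨v, hvS⟩ := Sᶜ.eq_empty_or_nonempty
    · rw [compl_eq_empty_iff] at hS
      simp [hS, partitionFn_univ]
    have hv : v ∉ S := mem_compl.1 hvS
    set N := G.neighborFinset v \ S with hN
    set d : V → ℝ := fun x => (#(G.neighborFinset x \ S) : ℝ) with hd
    have hvN : v ∉ N := by simp [hN]
    have hd0 : ∀ x, 0 ≤ d x := fun x => Nat.cast_nonneg _
    have hNc : N ⊆ (insert v S)ᶜ := fun w hw =>
      mem_compl.2 (not_mem_insert_of_mem_neighborFinset_sdiff hw)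
    -- Every remaining neighbor x of v has lost v, so its factor drops from 1 + d x to d x.
    have key : ∀ u ∈ insert v N, partitionFn G 1 (insert u (insert v S)) ^ 2 ≤
        (∏ x ∈ (insert v S)ᶜ \ N, (1 + d x)) * ∏ x ∈ N.erase u, d x := by
      intro u hu
      have hsub : (insert u (insert v S))ᶜ = ((insert v S)ᶜ \ N) ∪ N.erase u := by
        ext x
        have h1 : x ∈ N → x ∉ insert v S := fun hx => mem_compl.1 (hNc hx)
        simp only [mem_compl, mem_insert, mem_union, mem_sdiff, mem_erase] at hu h1 ⊢
        constructor
        · intro h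
          by_cases hx : x ∈ N
          · exact Or.inr ⟨fun e => h (Or.inl e), hx⟩
          · exact Or.inl ⟨fun e => h (Or.inr e), hx⟩
        · rintro (⟨h, hx⟩ | ⟨h, hx⟩) (rfl | e)
          · rcases hu with rfl | hu
            · exact h (Or.inl rfl)
            · exact hx hu
          · exact h e
          · exact h rfl
          · exact h1 hx e
      have hcard : #(insert u (insert v S))ᶜ < n := by
        rw [← hn]
        refine card_lt_card ⟨?_, fun h => ?_⟩
        · exact compl_subset_compl.2 ((subset_insert _ _).trans (subset_insert _ _))
        · simpa using h hvS
      refine (ih _ hcard (insert u (insert v S)) rfl).trans ?_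
      rw [hsub, prod_union (disjoint_left.2 fun x hx hx2 =>
        (mem_sdiff.1 hx).2 (mem_of_mem_erase hx2))]
      refine mul_le_mul ?_ ?_ (prod_nonneg fun x _ => by positivity)
        (prod_nonneg fun x _ => by positivity)
      · refine prod_le_prod (fun x _ => by positivity) fun x _ => ?_
        refine add_le_add_right (Nat.cast_le.2 (card_le_card ?_)) 1
        exact sdiff_subset_sdiff le_rfl ((subset_insert _ _).trans (subset_insert _ _))
      · refine prod_le_prod (fun x _ => by positivity) fun x hx => ?_
        have hxN : x ∈ N := mem_of_mem_erase hx
        have hlt : #(G.neighborFinset x \ insert u (insert v S)) < #(G.neighborFinset x \ S) := by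
          refine card_lt_card ⟨?_, fun h => ?_⟩
          · exact sdiff_subset_sdiff le_rfl ((subset_insert _ _).trans (subset_insert _ _))
          · have hadj : G.Adj v x := by simpa using (mem_sdiff.1 hxN).1
            have := h (mem_sdiff.2 ⟨by simpa using hadj.symm, hv⟩)
            simp at this
        rw [add_comm]
        simp only [hd]
        exact_mod_cast hlt
    have hsplit : ∏ x ∈ Sᶜ, (1 + d x) =
        (1 + d v) * ((∏ x ∈ (insert v S)ᶜ \ N, (1 + d x)) * ∏ x ∈ N, (1 + d x)) := by
      rw [prod_sdiff hNc, compl_insert, mul_prod_erase _ (fun x => 1 + d x) hvS]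
    rw [partitionFn_eq_sum_insert hv, hsplit]
    -- Cauchy–Schwarz over the 1 + d v choices for the image of v supplies the factor of v.
    refine sq_sum_le_card_mul_sum_sq.trans ?_
    rw [card_insert_of_notMem hvN, Nat.cast_add, Nat.cast_one, add_comm (#N : ℝ)]
    refine mul_le_mul_of_nonneg_left ((sum_le_sum key).trans ?_) (by positivity)
    rw [← mul_sum, sum_insert hvN, erase_eq_of_notMem hvN]
    exact mul_le_mul_of_nonneg_left (prod_add_sum_prod_erase_le N hd0)
      (prod_nonneg fun x _ => by have := hd0 x; positivity)

theorem log_partitionFn_one_le {Δ : ℕ} (hΔ : ∀ v, G.degree v ≤ Δ) :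
    2 * Real.log (partitionFn G 1 ∅) ≤ Fintype.card V * Real.log (1 + Δ) := by
  have h : partitionFn G 1 ∅ ^ 2 ≤ (1 + (Δ : ℝ)) ^ Fintype.card V := by
    refine (partitionFn_one_sq_le ∅).trans ?_
    refine (prod_le_prod (g := fun _ => 1 + (Δ : ℝ)) (fun v _ => by positivity)
      fun v _ => ?_).trans (by simp)
    simpa using hΔ v
  have := Real.log_le_log (pow_pos (partitionFn_pos one_pos _) 2) h
  rwa [Real.log_pow, Real.log_pow, Nat.cast_ofNat] at this

/-- The expected number of covered vertices, in terms of the marginals. -/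
theorem card_sub_sum_freeProb {r : ℝ} (hr : 0 < r) :
    Fintype.card V - ∑ v, freeProb G r ∅ v =
      ∑ f ∈ matchingPerms G ∅, r ^ #f.support / partitionFn G r ∅ * #f.support := by
  have hZ := partitionFn_pos (G := G) hr ∅
  have h1 : ∑ v, freeProb G r ∅ v = ∑ f ∈ matchingPerms G ∅,
      r ^ #f.support / partitionFn G r ∅ * (Fintype.card V - #f.support) := by
    have : ∀ f : Equiv.Perm V, ((Fintype.card V : ℝ) - #f.support) =
        ∑ v, if f v = v then (1 : ℝ) else 0 := by
      intro f
      rw [sum_boole, sub_eq_iff_eq_add, ← Nat.cast_add, ← card_univ,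
        ← card_filter_add_card_filter_not (s := univ) (fun v => f v = v)]
      rfl
    simp_rw [this, mul_sum]
    rw [sum_comm]
    refine sum_congr rfl fun v _ => ?_
    rw [freeProb, partitionFn, ← filter_matchingPerms_fixed, sum_div, sum_filter]
    refine sum_congr rfl fun f _ => ?_
    split_ifs <;> simp
  have h2 : ∑ f ∈ matchingPerms G ∅, r ^ #f.support / partitionFn G r ∅ = 1 := by
    rw [← sum_div, ← partitionFn, div_self hZ.ne']
  rw [h1, sub_eq_iff_eq_add, ← sum_add_distrib]
  simp_rw [← mul_add, add_sub_cancel]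
  rw [← sum_mul, h2, one_mul]

theorem card_sub_sum_freeProb_le {r : ℝ} (hr : 0 < r) {K : ℝ}
    (hK : ∀ f ∈ matchingPerms G ∅, (#f.support : ℝ) ≤ K) :
    Fintype.card V - ∑ v, freeProb G r ∅ v ≤ K := by
  have hZ := partitionFn_pos (G := G) hr ∅
  rw [card_sub_sum_freeProb hr]
  refine (sum_le_sum fun f hf => mul_le_mul_of_nonneg_left (hK f hf) (by positivity)).trans ?_
  rw [← sum_mul, ← sum_div, ← partitionFn, div_self hZ.ne', one_mul]

/-- This is Jensen for r^(−|supp f|) under the Gibbs measure, whose mean is Z_1/Z_r; it is obtained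
by averaging x + 1 ≤ exp x at x = (E − |supp f|) log r. -/
theorem log_partitionFn_le {r : ℝ} (hr : 0 < r) :
    Real.log (partitionFn G r ∅) ≤ Real.log (partitionFn G 1 ∅) +
      (Fintype.card V - ∑ v, freeProb G r ∅ v) * Real.log r := by
  have hZ := partitionFn_pos (G := G) hr ∅
  have hZ1 := partitionFn_pos (G := G) one_pos ∅
  set E := (Fintype.card V : ℝ) - ∑ v, freeProb G r ∅ v with hE
  have h : 1 ≤ partitionFn G 1 ∅ / partitionFn G r ∅ * Real.exp (E * Real.log r) := by
    have h2 : ∑ f ∈ matchingPerms G ∅, r ^ #f.support / partitionFn G r ∅ = 1 := by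
      rw [← sum_div, ← partitionFn, div_self hZ.ne']
    calc (1 : ℝ) = ∑ f ∈ matchingPerms G ∅, r ^ #f.support / partitionFn G r ∅ *
          ((E - #f.support) * Real.log r + 1) := by
          rw [card_sub_sum_freeProb hr] at hE
          have : ∀ f : Equiv.Perm V, r ^ #f.support / partitionFn G r ∅ *
              ((E - #f.support) * Real.log r + 1) =
              r ^ #f.support / partitionFn G r ∅ * (E * Real.log r + 1) -
              r ^ #f.support / partitionFn G r ∅ * #f.support * Real.log r := fun f => by ring
          simp_rw [this]
          rw [sum_sub_distrib, ← sum_mul, ← sum_mul, h2, ← hE]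
          ring
      _ ≤ ∑ f ∈ matchingPerms G ∅, 1 ^ #f.support / partitionFn G r ∅ *
          Real.exp (E * Real.log r) := by
          refine sum_le_sum fun f _ => ?_
          refine (mul_le_mul_of_nonneg_left (Real.add_one_le_exp _) (by positivity)).trans
            (le_of_eq ?_)
          have : Real.exp ((E - #f.support) * Real.log r) =
              Real.exp (E * Real.log r) / r ^ #f.support := by
            rw [sub_mul, Real.exp_sub, Real.exp_nat_mul, Real.exp_log hr]
          rw [this]
          field_simp
          simp
      _ = _ := by rw [← sum_mul, ← sum_div, ← partitionFn]
  have h3 := Real.log_le_log one_pos h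
  rw [Real.log_one, Real.log_mul (by positivity) (Real.exp_pos _).ne', Real.log_exp,
    Real.log_div hZ1.ne' hZ.ne'] at h3
  linarith

theorem support_mul_log_le {r : ℝ} (hr : 0 < r) {f : Equiv.Perm V} (hf : f ∈ matchingPerms G ∅) :
    #f.support * Real.log r ≤ Real.log (partitionFn G r ∅) := by
  rw [← Real.log_pow]
  refine Real.log_le_log (by positivity) ?_
  exact single_le_sum (f := fun f : Equiv.Perm V => r ^ #f.support)
    (fun f _ => by positivity) hf

/-- The base case 243 ≤ 256 explains the constant 4/5 in `log_one_add_le`, which in turn leaves room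
for the other errors. -/
theorem one_add_le_two_pow {Δ : ℕ} (hΔ : 2 ≤ Δ) : (1 + Δ) ^ 5 ≤ 2 ^ (4 * Δ) := by
  induction Δ, hΔ using Nat.le_induction with
  | base => norm_num
  | succ n hn ih =>
    have : 1 + (n + 1) ≤ (1 + n) * 4 / 3 := by omega
    calc (1 + (n + 1)) ^ 5 ≤ ((1 + n) * 4 / 3) ^ 5 := Nat.pow_le_pow_left this 5
      _ ≤ ((1 + n) ^ 5 * 4 ^ 5) / 3 ^ 5 := by
        rw [← mul_pow, Nat.le_div_iff_mul_le (by norm_num), ← mul_pow]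
        exact Nat.pow_le_pow_left (Nat.div_mul_le_self _ _) 5
      _ ≤ (1 + n) ^ 5 * 2 ^ 4 := by omega
      _ ≤ 2 ^ (4 * n) * 2 ^ 4 := Nat.mul_le_mul_right _ ih
      _ = 2 ^ (4 * (n + 1)) := by ring

theorem log_one_add_le {Δ : ℕ} (hΔ : 2 ≤ Δ) :
    Real.log (1 + Δ) ≤ 4 / 5 * (Δ * Real.log 2) := by
  have h : (1 + (Δ : ℝ)) ^ 5 ≤ 2 ^ (4 * Δ) := by exact_mod_cast one_add_le_two_pow hΔ
  have := Real.log_le_log (by positivity) h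
  rw [Real.log_pow, Real.log_pow] at this
  push_cast at this
  linarith

theorem support_sub_le_of_two_le {Δ : ℕ} (hΔ : ∀ v, G.degree v ≤ Δ) (h2 : 2 ≤ Δ) {r ε : ℝ}
    (hr : 0 < r) (hε : 0 < ε) (hlog : Real.log r = Δ * Real.log 2 / (4 * ε))
    {f : Equiv.Perm V} (hf : f ∈ matchingPerms G ∅) :
    #f.support - (Fintype.card V - ∑ v, freeProb G r ∅ v) ≤ 8 / 5 * ε * Fintype.card V := by
  have h := (support_mul_log_le hr hf).trans (log_partitionFn_le hr)
  have h1 := log_partitionFn_one_le hΔ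
  have h3 := mul_le_mul_of_nonneg_left (log_one_add_le h2) (Nat.cast_nonneg (Fintype.card V))
  have hpos : 0 < Δ * Real.log 2 := mul_pos (by positivity) (Real.log_pos one_lt_two)
  have hr0 : 0 < Real.log r := by rw [hlog]; positivity
  have hr1 : Δ * Real.log 2 = Real.log r * (4 * ε) := by rw [hlog]; field_simp
  rw [hr1] at h3
  refine le_of_mul_le_mul_right ?_ hr0
  nlinarith

theorem one_div_one_add_exp_le {ε : ℝ} (hε : 0 < ε) :
    1 / (1 + Real.exp (Real.log 2 / (2 * ε))) ≤ 8 / 5 * ε := by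
  set u := Real.log 2 / (2 * ε) with hu
  have hu0 : 0 < u := div_pos (Real.log_pos one_lt_two) (by positivity)
  have hεu : ε * u = Real.log 2 / 2 := by rw [hu]; field_simp
  have h2 := Real.log_two_gt_d9
  have h := Real.quadratic_le_exp_of_nonneg hu0.le
  rw [div_le_iff₀ (by positivity)]
  refine le_of_mul_le_mul_right ?_ hu0
  have : 8 / 5 * ε * (1 + Real.exp u) * u = 4 / 5 * Real.log 2 * (1 + Real.exp u) := by
    linear_combination 8 / 5 * (1 + Real.exp u) * hεu
  rw [this]
  nlinarith [sq_nonneg (u - 1)]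

/-- Here vw is an isolated edge, with only two configurations. -/
theorem freeProb_le_of_degree_le_one (hΔ : ∀ v, G.degree v ≤ 1) {r : ℝ} (hr : 0 < r) {v w : V}
    (hvw : G.Adj v w) : freeProb G r ∅ v ≤ 1 / (1 + r ^ 2) := by
  have hN : ∀ {x y}, G.Adj x y → G.neighborFinset x = {y} := by
    intro x y hxy
    refine (eq_of_subset_of_card_le (by simpa using hxy) ?_).symm
    simpa using hΔ x
  have h1 : freeProb G r (insert v ∅) w = 1 := by
    rw [freeProb_eq hr (by simpa using hvw.ne'), hN hvw.symm]
    simp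
  rw [freeProb_eq hr (notMem_empty v), hN hvw, sdiff_empty, sum_singleton, h1, mul_one]

/-- The entropy argument fails here, since log(1 + Δ) ≤ (4/5)Δ log 2 is false at Δ = 1 and log r = 0
at Δ = 0. The comparison is made vertex by vertex instead. -/
theorem support_sub_le_of_degree_le_one {Δ : ℕ} (hΔ : ∀ v, G.degree v ≤ Δ) (h1 : Δ ≤ 1) {r ε : ℝ}
    (hr : 0 < r) (hε : 0 < ε) (hrε : r ^ 2 = Real.exp (Δ * Real.log 2 / (2 * ε)))
    {f : Equiv.Perm V} (hf : f ∈ matchingPerms G ∅) :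
    #f.support - (Fintype.card V - ∑ v, freeProb G r ∅ v) ≤ 8 / 5 * ε * Fintype.card V := by
  have hbound : ∀ v ∈ univ, (if f v = v then (0 : ℝ) else 1) - (1 - freeProb G r ∅ v) ≤
      8 / 5 * ε := by
    intro v _
    split_ifs with h
    · have := freeProb_le_one (G := G) hr (notMem_empty v)
      have : 0 < 8 / 5 * ε := by positivity
      linarith
    · have hadj := (mem_matchingPerms.1 hf).2.1 v h
      have hΔ1 : Δ = 1 := by
        have : 0 < G.degree v := (G.degree_pos_iff_exists_adj v).2 ⟨_, hadj⟩
        have := hΔ v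
        omega
      subst hΔ1
      have := freeProb_le_of_degree_le_one hΔ hr hadj
      rw [hrε, Nat.cast_one, one_mul] at this
      linarith [one_div_one_add_exp_le hε]
  have h := sum_le_card_nsmul univ _ _ hbound
  rw [nsmul_eq_mul, card_univ, sum_sub_distrib, sum_sub_distrib, sum_const, card_univ,
    nsmul_eq_mul, mul_one] at h
  have hs : ∑ v, (if f v = v then (0 : ℝ) else 1) = #f.support := by
    simp [sum_ite, Equiv.Perm.support]
  rw [hs] at h
  linarith

theorem support_sub_le {Δ : ℕ} (hΔ : ∀ v, G.degree v ≤ Δ) {r ε : ℝ}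
    (hr : 0 < r) (hε : 0 < ε) (hrε : r ^ 2 = Real.exp (Δ * Real.log 2 / (2 * ε)))
    {f : Equiv.Perm V} (hf : f ∈ matchingPerms G ∅) :
    #f.support - (Fintype.card V - ∑ v, freeProb G r ∅ v) ≤ 8 / 5 * ε * Fintype.card V := by
  obtain h | h := le_or_gt Δ 1
  · exact support_sub_le_of_degree_le_one hΔ h hr hε hrε hf
  · refine support_sub_le_of_two_le hΔ h hr hε ?_ hf
    have := congrArg Real.log hrε
    rw [Real.log_pow, Real.log_exp, Nat.cast_ofNat] at this
    rw [show (Δ : ℝ) * Real.log 2 / (4 * ε) = Δ * Real.log 2 / (2 * ε) / 2 by field_simp; norm_num]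
    linarith

end Matching

/-! ### Involutions and matching subgraphs. -/

section MaxMatching

variable {V : Type*} [Fintype V] {G : SimpleGraph V}

theorem SimpleGraph.Subgraph.IsMatching.ncard_verts {M : G.Subgraph} (h : M.IsMatching) :
    M.verts.ncard = 2 * M.edgeSet.ncard := by
  classical
  have hdeg : ∀ v, M.spanningCoe.degree v = if v ∈ M.verts then 1 else 0 := by
    intro v
    rw [SimpleGraph.Subgraph.degree_spanningCoe]
    split_ifs with hv
    · exact SimpleGraph.Subgraph.isMatching_iff_forall_degree.1 h v hv
    · exact SimpleGraph.Subgraph.degree_of_notMem_verts hv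
  have h2 := M.spanningCoe.sum_degrees_eq_twice_card_edges
  rw [sum_congr rfl fun v _ => hdeg v, sum_boole, Nat.cast_id] at h2
  rw [← SimpleGraph.Subgraph.edgeSet_spanningCoe, ← SimpleGraph.coe_edgeFinset,
    Set.ncard_coe_finset, ← h2, ← Set.ncard_coe_finset]
  simp

variable (G) in
theorem bddAbove_matchingSizes :
    BddAbove {k : ℕ | ∃ M : G.Subgraph, M.IsMatching ∧ M.edgeSet.ncard = k} := by
  refine ⟨(Set.univ : Set (Sym2 V)).ncard, ?_⟩
  rintro k ⟨M, -, rfl⟩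
  exact Set.ncard_le_ncard (Set.subset_univ _) (Set.toFinite _)

variable [DecidableEq V] [DecidableRel G.Adj]

/-- The matching whose edges are the transpositions of an involution. -/
def matchingSubgraph {f : Equiv.Perm V} (hf : f ∈ matchingPerms G ∅) : G.Subgraph where
  verts := {v | f v ≠ v}
  Adj v w := f v ≠ v ∧ f v = w
  adj_sub := fun ⟨h1, h2⟩ => h2 ▸ (mem_matchingPerms.1 hf).2.1 _ h1
  edge_vert := fun h => h.1
  symm := ⟨fun v w ⟨h1, h2⟩ => by
    have := (mem_matchingPerms.1 hf).1 v
    subst h2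
    exact ⟨by rw [this]; exact h1.symm, this⟩⟩

theorem support_le_two_mul_maxMatchingSize {f : Equiv.Perm V} (hf : f ∈ matchingPerms G ∅) :
    #f.support ≤ 2 * maxMatchingSize G := by
  have hM : (matchingSubgraph hf).IsMatching := fun v hv => ⟨f v, ⟨hv, rfl⟩, fun w hw => hw.2.symm⟩
  have h1 : (matchingSubgraph hf).verts.ncard = #f.support := by
    rw [← Set.ncard_coe_finset]
    congr 1
    ext v
    simp [matchingSubgraph]
  rw [← h1, hM.ncard_verts]
  exact Nat.mul_le_mul_left 2 (le_csSup (bddAbove_matchingSizes G) ⟨_, hM, rfl⟩)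

theorem exists_support_eq_two_mul_maxMatchingSize :
    ∃ f ∈ matchingPerms G ∅, #f.support = 2 * maxMatchingSize G := by
  classical
  have hne : {k : ℕ | ∃ M : G.Subgraph, M.IsMatching ∧ M.edgeSet.ncard = k}.Nonempty :=
    ⟨_, ⊥, fun v hv => absurd hv (Set.notMem_empty v), rfl⟩
  obtain ⟨M, hM, hcard⟩ := Nat.sSup_mem hne (bddAbove_matchingSizes G)
  have hverts := hM.ncard_verts
  choose g hg hg' using hM
  -- The partner map of a maximum matching, extended by the identity.
  have hinv : Function.Involutive fun v => if h : v ∈ M.verts then g h else v := by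
    intro v
    by_cases hv : v ∈ M.verts
    · have hw := M.edge_vert (hg hv).symm
      simp only [hv, hw, dif_pos]
      exact (hg' hw v (hg hv).symm).symm
    · simp [hv]
  obtain ⟨F, hF⟩ : ∃ F : Equiv.Perm V, ∀ v, F v = if h : v ∈ M.verts then g h else v :=
    ⟨hinv.toPerm _, fun _ => rfl⟩
  have hval : ∀ v (h : v ∈ M.verts), F v = g h := fun v h => by simp [hF, h]
  have hval' : ∀ v, v ∉ M.verts → F v = v := fun v h => by simp [hF, h]
  refine ⟨F, mem_matchingPerms.2 ⟨fun v => by simpa only [hF] using hinv v, fun v hv => ?_, by simp⟩, ?_⟩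
  · have h : v ∈ M.verts := by
      by_contra h
      exact hv (hval' v h)
    rw [hval v h]
    exact (hg h).adj_sub
  · rw [maxMatchingSize, ← hcard, ← hverts, ← Set.ncard_coe_finset]
    congr 1
    ext v
    rw [mem_coe, Equiv.Perm.mem_support]
    refine ⟨fun hv => by_contra fun h => hv (hval' v h), fun h => ?_⟩
    rw [hval v h]
    exact (hg h).ne.symm

/-- The average size of a random matching of weight `r ^ 2` per edge is close to the maximum. -/
theorem two_mul_maxMatchingSize_bounds {Δ : ℕ} (hΔ : ∀ v, G.degree v ≤ Δ) {r ε : ℝ}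
    (hr : 0 < r) (hε : 0 < ε) (hrε : r ^ 2 = Real.exp (Δ * Real.log 2 / (2 * ε))) :
    Fintype.card V - ∑ v, freeProb G r ∅ v ≤ 2 * maxMatchingSize G ∧
      2 * maxMatchingSize G - (Fintype.card V - ∑ v, freeProb G r ∅ v) ≤
        8 / 5 * ε * Fintype.card V := by
  obtain ⟨f, hf, hcard⟩ := exists_support_eq_two_mul_maxMatchingSize (G := G)
  have h := support_sub_le hΔ hr hε hrε hf
  rw [hcard] at h
  push_cast at h
  refine ⟨card_sub_sum_freeProb_le hr fun f hf => ?_, h⟩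
  exact_mod_cast support_le_two_mul_maxMatchingSize hf

end MaxMatching

/-! ### Second moments of a uniform sample. -/

section Sampling

variable {V : Type*} [Fintype V]

theorem sum_pi_succ (s : ℕ) (F : (Fin (s + 1) → V) → ℝ) :
    ∑ U, F U = ∑ v, ∑ U : Fin s → V, F (Fin.cons v U) := by
  rw [← (Fin.consEquiv fun _ => V).sum_comp, Fintype.sum_prod_type]
  rfl

theorem sum_pi_sum_eq_zero {g : V → ℝ} (hg : ∑ v, g v = 0) (s : ℕ) :
    ∑ U : Fin s → V, ∑ j, g (U j) = 0 := by
  induction s with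
  | zero => simp
  | succ s ih =>
    rw [sum_pi_succ]
    simp_rw [Fin.sum_univ_succ, Fin.cons_zero, Fin.cons_succ, sum_add_distrib, ih]
    simp [← mul_sum, hg]

/-- Cross terms vanish by centering. The factor |V| on the left avoids the exponent s − 1. -/
theorem sum_pi_sum_sq {g : V → ℝ} (hg : ∑ v, g v = 0) (s : ℕ) :
    Fintype.card V * ∑ U : Fin s → V, (∑ j, g (U j)) ^ 2 =
      s * (Fintype.card V : ℝ) ^ s * ∑ v, g v ^ 2 := by
  induction s with
  | zero => simp
  | succ s ih =>
    rw [sum_pi_succ]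
    simp_rw [Fin.sum_univ_succ, Fin.cons_zero, Fin.cons_succ, add_sq, sum_add_distrib,
      ← mul_sum, sum_pi_sum_eq_zero hg]
    simp only [mul_zero, sum_const_zero, add_zero, sum_const, card_univ, nsmul_eq_mul,
      Fintype.card_pi, Fintype.card_fin, prod_const, ← mul_sum]
    rw [mul_add, ih]
    push_cast
    ring

/-- Chebyshev's inequality for the mean of a sample. -/
theorem two_thirds_le_uniform_sample [Nonempty V] {f : V → ℝ} (h0 : ∀ v, 0 ≤ f v)
    (h1 : ∀ v, f v ≤ 1) {s : ℕ} {δ : ℝ} (hs : 3 ≤ s * δ ^ 2) (hδ : 0 < δ) :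
    2 / 3 ≤ (PMF.uniformOfFintype (Fin s → V)).toOuterMeasure
      {U | |(∑ j, f (U j)) / s - (∑ v, f v) / Fintype.card V| ≤ δ} := by
  classical
  set n : ℝ := (Fintype.card V : ℝ) with hn
  have hn0 : 0 < n := Nat.cast_pos.2 Fintype.card_pos
  have hs0 : (0 : ℝ) < s := by
    rcases s.eq_zero_or_pos with rfl | h
    · norm_num at hs
    · exact_mod_cast h
  set μ := (∑ v, f v) / n with hμ
  have hμ0 : 0 ≤ μ := div_nonneg (sum_nonneg fun v _ => h0 v) hn0.le
  have hμ1 : μ ≤ 1 := by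
    rw [div_le_one hn0]
    exact (sum_le_card_nsmul univ f 1 fun v _ => h1 v).trans (by simp [hn])
  have hg : ∑ v, (f v - μ) = 0 := by
    rw [sum_sub_distrib, sum_const, card_univ, nsmul_eq_mul, hμ, ← hn]
    field_simp
    ring
  have hsum : ∀ U : Fin s → V, ∑ j, (f (U j) - μ) = s * ((∑ j, f (U j)) / s - μ) := by
    intro U
    rw [sum_sub_distrib, sum_const, card_univ, Fintype.card_fin, nsmul_eq_mul]
    field_simp
  set A : Finset (Fin s → V) := {U | |(∑ j, f (U j)) / s - μ| ≤ δ} with hA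
  have hbad : #Aᶜ * (s * δ) ^ 2 ≤ ∑ U : Fin s → V, (∑ j, (f (U j) - μ)) ^ 2 := by
    rw [← nsmul_eq_mul]
    refine (card_nsmul_le_sum Aᶜ _ _ fun U hU => ?_).trans
      (sum_le_sum_of_subset_of_nonneg (subset_univ _) fun _ _ _ => sq_nonneg _)
    have hU' : δ < |(∑ j, f (U j)) / s - μ| := by simpa [hA] using hU
    rw [hsum, mul_pow, mul_pow]
    refine mul_le_mul_of_nonneg_left (sq_le_sq.2 ?_) (sq_nonneg _)
    rw [abs_of_pos hδ]
    exact hU'.le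
  have hvar : ∑ v, (f v - μ) ^ 2 ≤ n := by
    refine (sum_le_card_nsmul univ _ 1 fun v _ => ?_).trans (by simp [hn])
    rw [sq_le_one_iff_abs_le_one, abs_le]
    constructor <;> linarith [h0 v, h1 v]
  have hcard : (#A : ℝ) + #Aᶜ = n ^ s := by
    rw [← Nat.cast_add, card_add_card_compl]
    simp [hn]
  -- Values in [0, 1] have variance at most 1, so the bad fraction is at most 1/(sδ²) ≤ 1/3.
  have hbound : 3 * (#Aᶜ : ℝ) ≤ n ^ s := by
    have h2 := sum_pi_sum_sq hg s
    rw [← hn] at h2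
    have h3 : n * (#Aᶜ * (s * δ) ^ 2) ≤ s * n ^ s * n :=
      (mul_le_mul_of_nonneg_left hbad hn0.le).trans
        (h2.le.trans (mul_le_mul_of_nonneg_left hvar (by positivity)))
    have h4 : (#Aᶜ : ℝ) * (s * δ ^ 2) ≤ n ^ s := by
      refine le_of_mul_le_mul_left ?_ (mul_pos hn0 hs0)
      linarith
    have := mul_le_mul_of_nonneg_left hs (Nat.cast_nonneg (α := ℝ) #Aᶜ)
    linarith
  have hcard0 : (0 : ℝ) < Fintype.card (Fin s → V) := Nat.cast_pos.2 Fintype.card_pos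
  have hreal : (2 / 3 : ℝ) ≤ #A / (Fintype.card (Fin s → V) : ℝ) := by
    rw [le_div_iff₀ hcard0]
    simp only [Fintype.card_pi, prod_const, card_univ, Fintype.card_fin, Nat.cast_pow, ← hn]
    linarith
  rw [PMF.toOuterMeasure_uniformOfFintype_apply]
  have hcA : Fintype.card {U : Fin s → V | |(∑ j, f (U j)) / s - μ| ≤ δ} = #A := by
    rw [Fintype.card_ofFinset]
    exact congrArg card (by ext; simp [hA])
  have := ENNReal.ofReal_le_ofReal hreal
  rw [ENNReal.ofReal_div_of_pos hcard0, ENNReal.ofReal_div_of_pos (by norm_num),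
    ENNReal.ofReal_natCast, ENNReal.ofReal_natCast, ENNReal.ofReal_ofNat,
    ENNReal.ofReal_ofNat] at this
  rwa [hcA]

end Sampling

/-! ### Numerical estimates for the query bound. -/

section Complexity

/-- With z = Δ/ε ≥ 2, each of λ, Δ and 1/ε is at most exp z, so the left side is bounded by a fixed
power of exp z. The inner `+ 1` pays for rounding up the number of rounds. -/
theorem rounds_add_le_exp {Δ : ℕ} {ε : ℝ} (hΔ : 1 ≤ Δ) (hε : 0 < ε) (hε2 : ε ≤ 1 / 2) :
    9 + ((Δ : ℝ) + 1) * (2 * (6 * (Real.exp (Δ * Real.log 2 / (2 * ε)) * Δ) ^ 2 / ε + 1) + 2) ≤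
      Real.exp (20 * (Δ / ε)) := by
  set z : ℝ := Δ / ε with hz
  have hΔ1 : (1 : ℝ) ≤ Δ := by exact_mod_cast hΔ
  have hz2 : 2 ≤ z := by
    rw [hz, le_div_iff₀ hε]
    linarith
  have hΔz : (Δ : ℝ) ≤ z := by
    rw [hz, le_div_iff₀ hε]
    nlinarith
  have hεz : 1 / ε ≤ z := by
    rw [hz]
    gcongr
  have hze : z ≤ Real.exp z := by linarith [Real.add_one_le_exp z]
  have hlam : Real.exp (Δ * Real.log 2 / (2 * ε)) ≤ Real.exp z := by
    refine Real.exp_le_exp.2 ?_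
    have h2 := Real.log_two_lt_d9
    rw [show (Δ : ℝ) * Real.log 2 / (2 * ε) = z * (Real.log 2 / 2) by rw [hz]; field_simp]
    nlinarith
  set E := Real.exp z with hE
  have hE2 : 2 ≤ E := hz2.trans hze
  have h1 : (Real.exp (Δ * Real.log 2 / (2 * ε)) * Δ) ^ 2 / ε ≤ E ^ 5 := by
    rw [div_eq_mul_one_div]
    calc _ ≤ (E * E) ^ 2 * E := by
          gcongr
          · exact hΔz.trans hze
          · exact hεz.trans hze
      _ = E ^ 5 := by ring
  have h2 : (Δ : ℝ) + 1 ≤ E ^ 2 := by nlinarith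
  have hpow : Real.exp (20 * z) = E ^ 20 := by
    rw [hE, ← Real.exp_nat_mul]
    norm_num
  rw [hpow, mul_div_assoc]
  have h5 : (2 : ℝ) ^ 5 ≤ E ^ 5 := by gcongr
  have h7 : (2 : ℝ) ^ 7 ≤ E ^ 7 := by gcongr
  have h13 : (2 : ℝ) ^ 13 ≤ E ^ 13 := by gcongr
  calc _ ≤ E ^ 7 + E ^ 2 * (2 * (6 * E ^ 5 + 1) + 2) := by
        gcongr
        linarith
    _ ≤ E ^ 7 + E ^ 2 * (13 * E ^ 5) := by
        gcongr
        linarith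
    _ = 14 * E ^ 7 := by ring
    _ ≤ E ^ 13 * E ^ 7 := by gcongr; linarith
    _ = E ^ 20 := by ring

/-- Since 1/ε ≥ 2, every factor is bounded by a power of 1/ε; the sample size takes the exponent 9.
-/
theorem sampleSize_mul_le {Δ H : ℕ} {ε t : ℝ} (hε : 0 < ε) (hε2 : ε ≤ 1 / 2)
    (ht : 9 + ((Δ : ℝ) + 1) * (2 * H + 2) ≤ t) :
    ((sampleSize 75 ε * ((H + 1) * (2 * Δ + 2) ^ (H + 1)) : ℕ) : ℝ) ≤ (1 / ε) ^ t := by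
  have hb : 2 ≤ 1 / ε := by
    rw [le_div_iff₀ hε]
    linarith
  set b := 1 / ε with hbdef
  have hs : (sampleSize 75 ε : ℝ) ≤ b ^ 9 := by
    have h1 := (Nat.ceil_lt_add_one (show 0 ≤ 75 / ε ^ 2 by positivity)).le
    have h2 : 75 / ε ^ 2 = 75 * b ^ 2 := by rw [hbdef]; field_simp
    have h7 : (2 : ℝ) ^ 7 ≤ b ^ 7 := by gcongr
    calc (sampleSize 75 ε : ℝ) ≤ 75 * b ^ 2 + 1 := by rw [← h2]; exact h1
      _ ≤ 2 ^ 7 * b ^ 2 := by nlinarith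
      _ ≤ b ^ 7 * b ^ 2 := by gcongr
      _ = b ^ 9 := by ring
  have hΔ : ((2 * Δ + 2 : ℕ) : ℝ) ≤ b ^ (Δ + 1) := by
    have h1 : 2 * Δ + 2 ≤ 2 ^ (Δ + 1) := by
      have := (Nat.lt_two_pow_self (n := Δ))
      rw [pow_succ]
      omega
    calc ((2 * Δ + 2 : ℕ) : ℝ) ≤ ((2 ^ (Δ + 1) : ℕ) : ℝ) := Nat.cast_le.2 h1
      _ = 2 ^ (Δ + 1) := by push_cast; rfl
      _ ≤ b ^ (Δ + 1) := by gcongr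
  have hH : ((H + 1 : ℕ) : ℝ) ≤ (b ^ (Δ + 1)) ^ (H + 1) := by
    have h1 : H + 1 ≤ 2 ^ (H + 1) := (Nat.lt_two_pow_self).le
    calc ((H + 1 : ℕ) : ℝ) ≤ ((2 ^ (H + 1) : ℕ) : ℝ) := Nat.cast_le.2 h1
      _ = 2 ^ (H + 1) := by push_cast; rfl
      _ ≤ (b ^ (Δ + 1)) ^ (H + 1) := by
        gcongr
        exact hb.trans (le_self_pow₀ (by linarith) (by omega))
  calc ((sampleSize 75 ε * ((H + 1) * (2 * Δ + 2) ^ (H + 1)) : ℕ) : ℝ)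
      = sampleSize 75 ε * (((H + 1 : ℕ) : ℝ) * ((2 * Δ + 2 : ℕ) : ℝ) ^ (H + 1)) := by
        push_cast; rfl
    _ ≤ b ^ 9 * ((b ^ (Δ + 1)) ^ (H + 1) * (b ^ (Δ + 1)) ^ (H + 1)) := by gcongr
    _ = b ^ (9 + (Δ + 1) * (2 * H + 2)) := by
        rw [← pow_mul, ← pow_add, ← pow_add]
        congr 1
        ring
    _ = b ^ ((9 + (Δ + 1) * (2 * H + 2) : ℕ) : ℝ) := (Real.rpow_natCast _ _).symm
    _ ≤ b ^ t := by
        refine Real.rpow_le_rpow_of_exponent_le (by linarith) ?_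
        push_cast
        exact ht

variable {V : Type*} [Fintype V] [DecidableEq V] {G : SimpleGraph V} [DecidableRel G.Adj]

theorem queries_approxMatchingStatistics_le_rpow (O : NeighborOracle G) {Δ : ℕ}
    (hΔ : ∀ v, G.degree v ≤ Δ) (h1 : 1 ≤ Δ) {ε : ℝ} (hε : 0 < ε) (hε2 : ε ≤ 1 / 2)
    (U : Fin (sampleSize 75 ε) → V) :
    ((approxMatchingStatistics (Real.exp (Δ * Real.log 2 / (2 * ε))) ε U).queries O : ℝ) ≤
      (1 / ε) ^ Real.exp (20 * (Δ / ε)) := by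
  set lam := Real.exp (Δ * Real.log 2 / (2 * ε)) with hlam
  have hlam0 : 0 < lam := Real.exp_pos _
  have hL : 0 < lam * Δ := mul_pos hlam0 (by exact_mod_cast h1)
  set H := ⌈6 * (lam * Δ) ^ 2 / ε⌉₊ with hH
  have hclose : ∀ v k, H ≤ k → |Real.log (pathMarginal G lam (k + 1) ∅ v) -
      Real.log (pathMarginal G lam k ∅ v)| ≤ ε / 2 / Real.exp 1 := fun v k hk =>
    (abs_log_pathMarginal_succ_sub_le hΔ hlam0.le k ∅ v).trans
      (pow_mul_log_le hL hε ((Nat.le_ceil _).trans (Nat.cast_le.2 hk)))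
  refine (Nat.cast_le.2 (queries_approxMatchingStatistics_le O lam ε U fun v =>
    queries_approxMarginal_le O hΔ lam (ε / 2) v (hclose v))).trans ?_
  refine sampleSize_mul_le hε hε2 (le_trans ?_ (rounds_add_le_exp h1 hε hε2))
  have := (Nat.ceil_lt_add_one (show 0 ≤ 6 * (lam * Δ) ^ 2 / ε by positivity)).le
  gcongr

end Complexity

/-! ### The error budget. -/

section Correctness

variable {V : Type*} [Fintype V] [DecidableEq V] [Nonempty V] {G : SimpleGraph V}
  [DecidableRel G.Adj]

theorem abs_output_sub_maxMatchingSize_le (O : NeighborOracle G) {Δ : ℕ}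
    (hΔ : ∀ v, G.degree v ≤ Δ) {ε r : ℝ} (hε : 0 < ε) (hr : 0 < r)
    (hrε : r ^ 2 = Real.exp (Δ * Real.log 2 / (2 * ε))) {s : ℕ} (U : Fin s → V)
    (hU : |(∑ j, (approxMarginal (r ^ 2) (ε / 2) (U j)).output O) / s -
      (∑ v, (approxMarginal (r ^ 2) (ε / 2) v).output O) / Fintype.card V| ≤ ε / 5) :
    |(approxMatchingStatistics (r ^ 2) ε U).output O - (maxMatchingSize G : ℝ)| ≤
      ε * Fintype.card V := by
  rw [output_approxMatchingStatistics]
  obtain ⟨hb1, hb2⟩ := two_mul_maxMatchingSize_bounds hΔ hr hε hrε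
  set n : ℝ := (Fintype.card V : ℝ) with hn
  have hn0 : 0 < n := Nat.cast_pos.2 Fintype.card_pos
  set q : V → ℝ := fun v => (approxMarginal (r ^ 2) (ε / 2) v).output O with hq
  have hmarg : |∑ v, q v - ∑ v, freeProb G r ∅ v| ≤ n * (ε / 5) := by
    rw [← sum_sub_distrib]
    refine (abs_sum_le_sum_abs _ _).trans ?_
    refine (sum_le_card_nsmul univ _ (ε / 5) fun v _ => ?_).trans (by simp [hn])
    refine (approxMarginal_spec O hr (half_pos hε) v).2.2.trans ?_
    rw [div_div]
    gcongr
    -- The accuracy (ε/2)/e is at most ε/5 because 2e > 5.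
    linarith [Real.exp_one_gt_d9]
  have hsample : |n * ((∑ j, q (U j)) / s) - ∑ v, q v| ≤ n * (ε / 5) := by
    have : n * ((∑ j, q (U j)) / s) - ∑ v, q v =
        n * ((∑ j, q (U j)) / s - (∑ v, q v) / n) := by field_simp
    rw [this, abs_mul, abs_of_pos hn0]
    exact mul_le_mul_of_nonneg_left hU hn0.le
  have hout : n / 2 - n / (2 * s) * ∑ j, q (U j) =
      n / 2 - n * ((∑ j, q (U j)) / s) / 2 := by
    rw [mul_comm (2 : ℝ), ← div_div]
    ring
  rw [hout]
  rw [abs_le] at hmarg hsample ⊢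
  constructor <;> nlinarith [mul_pos hε hn0]

theorem two_thirds_le_approxMatchingStatistics (O : NeighborOracle G) {Δ : ℕ}
    (hΔ : ∀ v, G.degree v ≤ Δ) {ε : ℝ} (hε : 0 < ε) :
    2 / 3 ≤ (PMF.uniformOfFintype (Fin (sampleSize 75 ε) → V)).toOuterMeasure
      {U | |(approxMatchingStatistics (Real.exp (Δ * Real.log 2 / (2 * ε))) ε U).output O -
        (maxMatchingSize G : ℝ)| ≤ ε * Fintype.card V} := by
  obtain ⟨r, hr, hrε⟩ : ∃ r : ℝ, 0 < r ∧ r ^ 2 = Real.exp (Δ * Real.log 2 / (2 * ε)) :=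
    ⟨√(Real.exp (Δ * Real.log 2 / (2 * ε))), Real.sqrt_pos.2 (Real.exp_pos _),
      Real.sq_sqrt (Real.exp_pos _).le⟩
  -- The constant 75 = 3 · 5²: deviation ε/5 with failure probability at most 1/3.
  have hs : 3 ≤ (sampleSize 75 ε : ℝ) * (ε / 5) ^ 2 := by
    have := Nat.le_ceil (75 / ε ^ 2)
    rw [div_le_iff₀ (by positivity)] at this
    rw [sampleSize]
    linarith
  have hspec := approxMarginal_spec O hr (half_pos hε)
  refine (two_thirds_le_uniform_sample (fun v => (hspec v).1.le) (fun v => (hspec v).2.1) hs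
    (by positivity)).trans (MeasureTheory.measure_mono fun U hU => ?_)
  rw [← hrε]
  exact abs_output_sub_maxMatchingSize_le O hΔ hε hr hrε U hU

end Correctness

end ApproxMatching

theorem mainTheorem9 :
    ∃ C : ℝ, 0 < C ∧
    ∃ T Q : ℕ × ℝ → ℝ,
      IsSoftO {a : ℕ × ℝ | 1 ≤ a.1 ∧ 0 < a.2 ∧ a.2 ≤ 1 / 2} T (fun a => a.1 / a.2) ∧
      IsSoftO {a : ℕ × ℝ | 1 ≤ a.1 ∧ 0 < a.2 ∧ a.2 ≤ 1 / 2} Q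
        (fun a => (1 / a.2) ^ Real.exp (T a)) ∧
      ∀ (Δ : ℕ) (ε lam : ℝ), 0 < ε → lam = Real.exp (Δ * Real.log 2 / (2 * ε)) →
      ∀ (V : Type*) [Fintype V] [DecidableEq V] [Nonempty V]
        (G : SimpleGraph V) [DecidableRel G.Adj] (O : NeighborOracle G),
        (∀ v, G.degree v ≤ Δ) →
        2 / 3 ≤ (PMF.uniformOfFintype (Fin (sampleSize C ε) → V)).toOuterMeasure
            {U | |(approxMatchingStatistics lam ε U).output O - (maxMatchingSize G : ℝ)|
                ≤ ε * Fintype.card V} ∧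
        (1 ≤ Δ → ε ≤ 1 / 2 → ∀ U : Fin (sampleSize C ε) → V,
          ((approxMatchingStatistics lam ε U).queries O : ℝ) ≤ Q (Δ, ε)) := by
  refine ⟨75, by norm_num, fun a => 20 * (a.1 / a.2),
    fun a => (1 / a.2) ^ Real.exp (20 * (a.1 / a.2)), ⟨20, 0, ?_⟩, ⟨1, 0, ?_⟩, ?_⟩
  · rintro ⟨Δ, ε⟩ ⟨-, hε, -⟩
    have : (0 : ℝ) ≤ 20 * (Δ / ε) := by
      have : 0 < ε := hε
      positivity
    simp only [pow_zero, mul_one]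
    exact (abs_of_nonneg this).le
  · rintro ⟨Δ, ε⟩ ⟨-, hε, -⟩
    have : 0 < ε := hε
    simp only [pow_zero, mul_one, one_mul]
    exact (abs_of_nonneg (by positivity)).le
  · rintro Δ ε lam hε rfl V _ _ _ G _ O hΔ
    exact ⟨two_thirds_le_approxMatchingStatistics O hΔ hε, fun h1 hε2 U =>
      queries_approxMatchingStatistics_le_rpow O hΔ h1 hε hε2 U⟩
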